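/- Let $1\le n<M$ be integers and let $0<p\le q\le\infty$. For $0<r<\infty$ and $x\in\mathbb{R}^M$ write $\|x\|_{\ell_r}=\big(\sum_{i=1}^M|x_i|^r\big)^{1/r}$, and $\|x\|_{\ell_\infty}=\max_i|x_i|$. Let $$K_q^M=\Big\{x\in\mathbb{R}^M:\ \sum_{i=1}^M|x_i|^q\le 1\Big\}\quad(q<\infty),\qquad K_\infty^M=\{x\in\mathbb{R}^M:\ |x_i|\le 1\text{ for all }i\}$$ be the unit ball of $\ell_q^M$, and define its manifold $n$-width in the $\ell_p$-(quasi-)norm by $$\delta_n(K_q^M)_p=\inf_{a,m}\ \sup_{x\in K_q^M}\|x-m(a(x))\|_{\ell_p},$$ where the infimum is over all pairs of continuous maps $a:K_q^M\to\mathbb{R}^n$ and $m:\mathbb{R}^n\to\mathbb{R}^M$. Then $$\delta_n(K_q^M)_p=(M-n)^{1/p-1/q},$$ where $1/\infty=0$. -/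

import Mathlib

open scoped ENNReal

noncomputable section

/-- The manifold `n`-width of `K` in `X`: the infimum, over all continuous encoders
`a : K → ℝⁿ` and all continuous decoders `m : ℝⁿ → X`, of the worst-case error
`sup_{f ∈ K} ‖f - m (a f)‖`. It takes values in `[0, ∞]`, so that the infimum and the supremum
always have their order-theoretic meaning. The norm of `X` and its topology are separate
arguments, so that quasi-normed spaces (such as `ℓ_p` with `p < 1`) are covered. -/
def manifoldWidth {X : Type*} [TopologicalSpace X] [AddCommGroup X] [Norm X]
    (n : ℕ) (K : Set X) : ℝ≥0∞ :=
  ⨅ (a : C(K, EuclideanSpace ℝ (Fin n))) (m : C(EuclideanSpace ℝ (Fin n), X)),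
    ⨆ f : K, ENNReal.ofReal ‖(f : X) - m (a f)‖

/-- The space `ℓ_p^M`, i.e. `ℝ^M` with its usual topology and the (quasi-)norm
`(∑ |x_i|^p)^(1/p)` for `0 < p < ∞`, respectively `max |x_i|` for `p = ∞`. -/
abbrev EllP (p : ℝ≥0∞) (M : ℕ) : Type := PiLp p (fun _ : Fin M => ℝ)

/-- The unit ball `K_q^M` of `ℓ_q^M`, as a subset of the space `ℓ_p^M`. -/
def ellUnitBall (p q : ℝ≥0∞) (M : ℕ) : Set (EllP p M) :=
  {x | if q = ∞ then ∀ i, |x i| ≤ 1 else ∑ i, |x i| ^ q.toReal ≤ 1}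

end

/-! Upper bound: encode by the first `n` coordinates and decode by padding with zeros; the error has
at most `M - n` nonzero entries, and Hölder bounds it (`norm_le_rpow_of_eq_zero_off`).

Lower bound: perturb the decoder `m` uniformly to an `m'` of which no `n + 1` coordinates vanish
together, which is possible because its source has dimension `n`. On the compact range of `a`, at
most `n` coordinates of `m'` are then below some `ε > 0`. Let `G z` be a point of the ball with
signs opposite to `z`, obtained by rescaling a cube vector that is unimodular wherever `|z i| ≥ ε`.
Brouwer gives a fixed point `y = a (G (m' y))`. The point `x = G (m' y)` is encoded as `y`,
subtracting `m' y` shrinks none of its coordinates, and at least `M - n` unimodular coordinates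
before rescaling make its norm large. Compactness removes the perturbation. The comparison is
coordinatewise, so no triangle inequality is needed when `p < 1`.

Brouwer's theorem comes from the analytic no-retraction argument: the integral of `det (1 + t • Dg)`
over the ball is a polynomial in `t`, constant for small `t > 0`. -/

open MeasureTheory Metric Set
open scoped NNReal RealInnerProductSpace

/-! ### Brouwer's fixed point theorem -/

/-- `det (1 + A)` is a fixed linear combination of the values `det (1 + t • A)` at
`finrank + 1` distinct nodes `t`. -/
theorem sum_lagrange_mul_det_one_add_smul {E : Type*} [NormedAddCommGroup E] [NormedSpace ℝ E]
    [FiniteDimensional ℝ E] {s : Finset ℕ} {v : ℕ → ℝ} (hv : Set.InjOn v s)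
    (hs : Module.finrank ℝ E < s.card) (A : E →L[ℝ] E) :
    ∑ i ∈ s, (Lagrange.basis s v i).eval 1 * (1 + v i • A).det = (1 + A).det := by
  let b := Module.finBasis ℝ E
  let N := LinearMap.toMatrix b b (A : E →ₗ[ℝ] E)
  let P : Polynomial ℝ := ((Polynomial.X : Polynomial ℝ) • N.map Polynomial.C
    + (1 : Matrix _ _ ℝ).map Polynomial.C).det
  have hP (t : ℝ) : P.eval t = (1 + t • A).det := by
    have h1 : (1 + t • A).det = (1 + t • N).det := by
      rw [ContinuousLinearMap.det, ← LinearMap.det_toMatrix b]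
      congr 1
      simp [N, Module.End.one_eq_id]
    rw [h1, ← Polynomial.coe_evalRingHom, RingHom.map_det]
    congr 1
    ext i j
    simp [Matrix.one_apply, add_comm]
    split_ifs <;> simp [mul_comm]
  have hdeg : P.degree < s.card := by
    refine lt_of_le_of_lt Polynomial.degree_le_natDegree ?_
    have := Polynomial.natDegree_det_X_add_C_le N 1
    rw [Fintype.card_fin] at this
    exact_mod_cast lt_of_le_of_lt this hs
  have h := congrArg (Polynomial.eval 1)
    (Lagrange.eq_interpolate_of_eval_eq (r := fun i => P.eval (v i)) hv hdeg (fun _ _ => rfl))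
  rw [Lagrange.interpolate_apply, Polynomial.eval_finsetSum, hP] at h
  simp only [Polynomial.eval_mul, Polynomial.eval_C, hP, one_smul] at h
  rw [h]
  exact Finset.sum_congr rfl fun i _ => mul_comm _ _

/-- Extending a map that vanishes on the unit sphere by zero keeps the Lipschitz constant. -/
theorem LipschitzOnWith.indicator_ball {E F : Type*} [NormedAddCommGroup E] [NormedSpace ℝ E]
    [NormedAddCommGroup F] {g : E → F} {L : ℝ≥0}
    (hg : LipschitzOnWith L g (closedBall 0 1)) (h0 : ∀ x ∈ sphere (0 : E) 1, g x = 0) :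
    LipschitzWith L ((ball (0 : E) 1).indicator g) := by
  have key : ∀ x ∈ ball (0 : E) 1, ∀ y ∉ ball (0 : E) 1, dist (g x) 0 ≤ L * dist x y := by
    intro x hx y hy
    -- The segment from `x` to `y` crosses the sphere at some `z`, where `g` vanishes; `z` is no
    -- farther from `x` than `y` is.
    obtain ⟨z, hz, hz'⟩ := (convex_segment x y).isPreconnected.intermediate_value
      (left_mem_segment ℝ x y) (right_mem_segment ℝ x y) continuous_norm.continuousOn
      ⟨(mem_ball_zero_iff.1 hx).le, not_lt.1 (mt mem_ball_zero_iff.2 hy)⟩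
    have hzs : z ∈ sphere (0 : E) 1 := mem_sphere_zero_iff_norm.2 hz'
    rw [← h0 z hzs]
    refine (hg.dist_le_mul x (ball_subset_closedBall hx) z (sphere_subset_closedBall hzs)).trans ?_
    gcongr
    have := dist_add_dist_of_mem_segment hz
    linarith [dist_nonneg (x := z) (y := y)]
  refine LipschitzWith.of_dist_le_mul fun x y => ?_
  by_cases hx : x ∈ ball (0 : E) 1 <;> by_cases hy : y ∈ ball (0 : E) 1
  · rw [indicator_of_mem hx, indicator_of_mem hy]
    exact hg.dist_le_mul x (ball_subset_closedBall hx) y (ball_subset_closedBall hy)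
  · rw [indicator_of_mem hx, indicator_of_notMem hy]
    exact key x hx y hy
  · rw [indicator_of_notMem hx, indicator_of_mem hy, dist_comm, dist_comm x y]
    exact key y hy x hx
  · rw [indicator_of_notMem hx, indicator_of_notMem hy, dist_self]
    positivity

/-- A small Lipschitz perturbation of the identity that is supported in a set maps that set
bijectively onto itself. -/
theorem bijOn_id_add_of_lipschitz {E : Type*} [NormedAddCommGroup E] [NormedSpace ℝ E]
    [CompleteSpace E] {g : E → E} {c : ℝ≥0} (hg : LipschitzWith c g) (hc : c < 1) {s : Set E}
    (hs : ∀ x ∉ s, g x = 0) : BijOn (fun x => x + g x) s s := by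
  rcases subsingleton_or_nontrivial E with hE | hE
  · have : (fun x : E => x + g x) = id := by ext x; exact Subsingleton.elim _ _
    rw [this]; exact bijOn_id s
  have hA : ApproximatesLinearOn (fun x => x + g x)
      ((ContinuousLinearEquiv.refl ℝ E : E ≃L[ℝ] E) : E →L[ℝ] E) univ c := by
    intro x _ y _
    have := hg.dist_le_mul x y
    rw [dist_eq_norm, dist_eq_norm] at this
    rwa [show x + g x - (y + g y) -
      ((ContinuousLinearEquiv.refl ℝ E : E ≃L[ℝ] E) : E →L[ℝ] E) (x - y) = g x - g y by
        change x + g x - (y + g y) - (x - y) = _; abel]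
  have hc' : Subsingleton E ∨
      c < ‖((ContinuousLinearEquiv.refl ℝ E).symm : E →L[ℝ] E)‖₊⁻¹ := by
    right
    have : ‖((ContinuousLinearEquiv.refl ℝ E).symm : E →L[ℝ] E)‖₊ = 1 := by
      ext; simp
    rw [this]; simpa using hc
  have hinj := injOn_univ.1 (hA.injOn hc')
  have hsurj := hA.surjective hc'
  have hfix : ∀ x ∉ s, x + g x = x := fun x hx => by rw [hs x hx, add_zero]
  refine ⟨fun x hx => ?_, hinj.injOn, fun y hy => ?_⟩
  -- An image outside `s` would itself be a fixed point, so injectivity would identify it with `x ∈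
  -- s`.
  · by_contra h
    have hx' : x = x + g x := hinj (hfix _ h).symm
    exact h (by rwa [hx'] at hx)
  · obtain ⟨x, rfl⟩ := hsurj y
    refine ⟨x, ?_, rfl⟩
    by_contra h
    simp only [hfix x h] at hy
    exact h hy

/-- There is no continuously differentiable retraction of the closed unit ball onto the unit
sphere. -/
theorem not_exists_contDiffOn_retraction {E : Type*} [NormedAddCommGroup E]
    [InnerProductSpace ℝ E] [FiniteDimensional ℝ E] {r : E → E}
    (hr : ContDiffOn ℝ 1 r (closedBall 0 1)) (hr1 : ∀ x ∈ closedBall (0 : E) 1, ‖r x‖ = 1)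
    (hr2 : ∀ x ∈ sphere (0 : E) 1, r x = x) : False := by
  let _ : MeasurableSpace E := borel E
  have : BorelSpace E := ⟨rfl⟩
  let μ : Measure E := Measure.addHaar
  set g : E → E := fun x => r x - x with hgdef
  have hg : ContDiffOn ℝ 1 g (closedBall 0 1) := hr.sub contDiffOn_id
  obtain ⟨L, hL⟩ := hg.exists_lipschitzOnWith one_ne_zero (convex_closedBall 0 1)
    (isCompact_closedBall 0 1)
  have hg0 : ∀ x ∈ sphere (0 : E) 1, g x = 0 := fun x hx => by simp [hgdef, hr2 x hx]
  set B := ball (0 : E) 1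
  have hGL := hL.indicator_ball hg0
  have hder : ∀ x ∈ B, HasFDerivAt g (fderiv ℝ g x) x := fun x hx =>
    ((hg.differentiableOn one_ne_zero).differentiableAt
      (Filter.mem_of_superset (isOpen_ball.mem_nhds hx) ball_subset_closedBall)).hasFDerivAt
  have hderL : ∀ x ∈ B, ‖fderiv ℝ g x‖ ≤ L := fun x hx =>
    (hder x hx).le_of_lipschitzOn (Filter.mem_of_superset (isOpen_ball.mem_nhds hx)
      ball_subset_closedBall) hL
  obtain ⟨δ, hδ, hδdet⟩ : ∃ δ > 0, ∀ A : E →L[ℝ] E, ‖A‖ < δ → 0 < (1 + A).det := by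
    have hcont : Continuous fun A : E →L[ℝ] E => (1 + A).det :=
      ContinuousLinearMap.continuous_det.comp (continuous_const.add continuous_id)
    have h0 : (0 : ℝ) < (1 + (0 : E →L[ℝ] E)).det := by
      rw [add_zero]; simp [ContinuousLinearMap.det]
    obtain ⟨δ, hδ, h⟩ := Metric.eventually_nhds_iff.1
      (hcont.continuousAt.eventually (lt_mem_nhds h0))
    exact ⟨δ, hδ, fun A hA => h (by simpa using hA)⟩
  -- For `t ≤ τ`, `t * L < 1` makes `x + t • g x` a bijection of the ball, and `t * L < δ` makes its
  -- Jacobian positive.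
  set τ : ℝ := min 1 δ / (2 * (L + 1)) with hτ
  have hτpos : 0 < τ := by positivity
  have hτL : τ * L < min 1 δ := by
    have : τ * (2 * (L + 1)) = min 1 δ := by rw [hτ]; field_simp
    nlinarith [L.coe_nonneg, hτpos]
  have hsmall : ∀ t ∈ Ioc 0 τ, IntegrableOn (fun x => (1 + t • fderiv ℝ g x).det) B μ ∧
      ∫ x in B, (1 + t • fderiv ℝ g x).det ∂μ = μ.real B := by
    intro t ht
    have htL : t * L < min 1 δ :=
      (mul_le_mul_of_nonneg_right ht.2 L.coe_nonneg).trans_lt hτL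
    have hlip : LipschitzWith (t.toNNReal * L) (fun x => t • B.indicator g x) := by
      refine LipschitzWith.of_dist_le_mul fun x y => ?_
      rw [dist_smul₀, NNReal.coe_mul, Real.coe_toNNReal _ ht.1.le, Real.norm_of_nonneg ht.1.le,
        mul_assoc]
      exact mul_le_mul_of_nonneg_left (hGL.dist_le_mul x y) ht.1.le
    have hlt : t.toNNReal * L < 1 := by
      rw [← NNReal.coe_lt_coe, NNReal.coe_mul, Real.coe_toNNReal _ ht.1.le]
      exact htL.trans_le (min_le_left _ _)
    have hbij := bijOn_id_add_of_lipschitz hlip hlt (s := B)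
      (fun x hx => by rw [indicator_of_notMem hx, smul_zero])
    have hd : ∀ x ∈ B, HasFDerivWithinAt (fun x => x + t • B.indicator g x)
        (1 + t • fderiv ℝ g x) B x := by
      intro x hx
      have h1 : HasFDerivAt (fun x => x + t • g x) (1 + t • fderiv ℝ g x) x :=
        (hasFDerivAt_id x).add ((hder x hx).const_smul t)
      exact h1.hasFDerivWithinAt.congr (fun y hy => by rw [indicator_of_mem hy])
        (by rw [indicator_of_mem hx])
    have hpos : ∀ x ∈ B, 0 < (1 + t • fderiv ℝ g x).det := fun x hx => hδdet _ <| by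
      rw [norm_smul, Real.norm_of_nonneg ht.1.le]
      exact ((mul_le_mul_of_nonneg_left (hderL x hx) ht.1.le).trans_lt htL).trans_le
        (min_le_right _ _)
    have hBm : MeasurableSet B := measurableSet_ball
    have hint := integrableOn_image_iff_integrableOn_abs_det_fderiv_smul μ hBm hd hbij.injOn
      (fun _ => (1 : ℝ))
    have hval := integral_image_eq_integral_abs_det_fderiv_smul μ hBm hd hbij.injOn
      (fun _ => (1 : ℝ))
    rw [hbij.image_eq] at hint hval
    have hcongr : EqOn (fun x => |(1 + t • fderiv ℝ g x).det| • (1 : ℝ))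
        (fun x => (1 + t • fderiv ℝ g x).det) B := fun x hx => by
      simp [abs_of_pos (hpos x hx)]
    constructor
    · refine (integrableOn_congr_fun hcongr hBm).1 (hint.1 ?_)
      exact integrableOn_const measure_ball_lt_top.ne
    · rw [← setIntegral_congr_fun hBm hcongr, ← hval]
      simp [Measure.real]
  -- Differentiating `‖r‖ ^ 2 = 1` shows `r x` orthogonal to the range of the derivative of `r`; if
  -- that derivative were onto, `r x` would be orthogonal to itself.
  have hzero : ∀ x ∈ B, (1 + fderiv ℝ g x).det = 0 := by
    intro x hx
    by_contra hne
    have hrd : HasFDerivAt r (1 + fderiv ℝ g x) x := by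
      have := (hasFDerivAt_id x).add (hder x hx)
      refine this.congr_of_eventuallyEq (Filter.Eventually.of_forall fun y => ?_)
      simp [hgdef]
    have hn : HasFDerivAt (fun y => ‖r y‖ ^ 2) (0 : E →L[ℝ] ℝ) x := by
      refine (hasFDerivAt_const (1 : ℝ) x).congr_of_eventuallyEq ?_
      filter_upwards [isOpen_ball.mem_nhds hx] with y hy
      rw [hr1 y (ball_subset_closedBall hy), one_pow]
    have h0 := hn.unique hrd.norm_sq
    have hsurj : Function.Surjective ((1 : E →L[ℝ] E) + fderiv ℝ g x) := by
      exact (LinearMap.equivOfDetNeZero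
        ((1 + fderiv ℝ g x : E →L[ℝ] E) : E →ₗ[ℝ] E) hne).surjective
    obtain ⟨w, hw⟩ := hsurj (r x)
    have := congrArg (fun A : E →L[ℝ] ℝ => A w) h0
    have hrx := hr1 x (ball_subset_closedBall hx)
    simp only [zero_apply, smul_apply,
      ContinuousLinearMap.comp_apply, innerSL_apply_apply, hw, real_inner_self_eq_norm_sq,
      hrx] at this
    norm_num at this
  set d := Module.finrank ℝ E
  let s := Finset.range (d + 1)
  let v : ℕ → ℝ := fun i => τ / (i + 1)
  have hv : InjOn v s := by
    intro i _ j _ hij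
    have h1 : (0 : ℝ) < i + 1 := by positivity
    have h2 : (0 : ℝ) < j + 1 := by positivity
    simp only [v] at hij
    rw [div_eq_div_iff h1.ne' h2.ne'] at hij
    have := mul_left_cancel₀ hτpos.ne' hij
    exact_mod_cast (add_right_cancel this).symm
  have hvmem : ∀ i, v i ∈ Ioc 0 τ := fun i =>
    ⟨by positivity, div_le_self hτpos.le (by linarith [i.cast_nonneg (α := ℝ)])⟩
  have hcard : d < s.card := by simp [s]
  have hB : 0 < μ.real B := by
    rw [Measure.real, ENNReal.toReal_pos_iff]
    exact ⟨measure_ball_pos μ 0 one_pos, measure_ball_lt_top⟩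
  have hsum1 : ∑ i ∈ s, (Lagrange.basis s v i).eval 1 = 1 := by
    rw [← Polynomial.eval_finsetSum, Lagrange.sum_basis hv (by simp [s]), Polynomial.eval_one]
  have h1 : ∫ x in B, (1 + fderiv ℝ g x).det ∂μ = 0 := by
    rw [setIntegral_congr_fun measurableSet_ball hzero]; simp
  -- The value at `t = 1` is extrapolated from nodes in `(0, τ]`, where every integral is the volume
  -- of the ball; the Lagrange weights sum to `1`.
  have h2 : ∫ x in B, (1 + fderiv ℝ g x).det ∂μ = μ.real B := by
    have h3 : (fun x => (1 + fderiv ℝ g x).det) = fun x =>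
        ∑ i ∈ s, (Lagrange.basis s v i).eval 1 * (1 + v i • fderiv ℝ g x).det := by
      ext x; exact (sum_lagrange_mul_det_one_add_smul hv hcard _).symm
    rw [h3, integral_finsetSum _ fun i _ => ((hsmall _ (hvmem i)).1.const_mul _)]
    simp_rw [integral_const_mul, (hsmall _ (hvmem _)).2]
    rw [← Finset.sum_mul, hsum1, one_mul]
  linarith

/-- A continuously differentiable map into the open unit ball has a fixed point. -/
theorem ContDiff.exists_fixedPoint_of_norm_lt_one {E : Type*} [NormedAddCommGroup E]
    [InnerProductSpace ℝ E] [FiniteDimensional ℝ E] {k : E → E} (hk : ContDiff ℝ 1 k)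
    (hk1 : ∀ x, ‖k x‖ < 1) : ∃ x, k x = x := by
  by_contra! hne
  set d : E → E := fun x => x - k x
  have hd : ContDiff ℝ 1 d := contDiff_id.sub hk
  have hd0 : ∀ x, ‖d x‖ ^ 2 ≠ 0 := fun x => by
    exact pow_ne_zero 2 (norm_ne_zero_iff.2 (sub_ne_zero.2 (hne x).symm))
  -- A quarter of the discriminant of `‖x + s • d x‖ ^ 2 = 1` as a quadratic in `s`. The larger
  -- root, used below, pushes `x` away from `k x` to the sphere; strict positivity on the closed
  -- ball keeps the square root smooth.
  set disc : E → ℝ := fun x => ⟪x, d x⟫ ^ 2 + ‖d x‖ ^ 2 * (1 - ‖x‖ ^ 2)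
  have hdisc : ContDiff ℝ 1 disc :=
    ((contDiff_id.inner ℝ hd).pow 2).add ((hd.norm_sq ℝ).mul
      (contDiff_const.sub (contDiff_id.norm_sq ℝ)))
  have hsphere : ∀ x, ‖x‖ = 1 → 0 < ⟪x, d x⟫ := by
    intro x hx
    have h1 : ⟪x, k x⟫ ≤ ‖x‖ * ‖k x‖ := real_inner_le_norm x (k x)
    have h2 := hk1 x
    rw [hx, one_mul] at h1
    change 0 < ⟪x, x - k x⟫
    rw [inner_sub_right, real_inner_self_eq_norm_sq, hx]
    linarith
  have hpos : ∀ x ∈ closedBall (0 : E) 1, 0 < disc x := by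
    intro x hx
    rw [mem_closedBall_zero_iff] at hx
    have hdp : 0 < ‖d x‖ ^ 2 := lt_of_le_of_ne (sq_nonneg _) (hd0 x).symm
    rcases hx.lt_or_eq with h | h
    · have : 0 < 1 - ‖x‖ ^ 2 := by nlinarith [norm_nonneg x]
      have := mul_pos hdp this
      exact add_pos_of_nonneg_of_pos (sq_nonneg _) this
    · have := hsphere x h
      refine add_pos_of_pos_of_nonneg (pow_pos this 2) ?_
      rw [h]; norm_num
  let s : E → ℝ := fun x => (-⟪x, d x⟫ + √(disc x)) / ‖d x‖ ^ 2
  refine not_exists_contDiffOn_retraction (r := fun x => x + s x • d x) ?_ ?_ ?_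
  · have hs : ContDiffOn ℝ 1 s (closedBall 0 1) := by
      refine ContDiffOn.div ?_ (hd.norm_sq ℝ).contDiffOn fun x _ => hd0 x
      exact (contDiff_id.inner ℝ hd).contDiffOn.neg.add
        (hdisc.contDiffOn.sqrt fun x hx => (hpos x hx).ne')
    exact contDiffOn_id.add (hs.smul hd.contDiffOn)
  · intro x hx
    have hsq := Real.sq_sqrt (hpos x hx).le
    have hsd : s x * ‖d x‖ ^ 2 = -⟪x, d x⟫ + √(disc x) := div_mul_cancel₀ _ (hd0 x)
    have h1 : ‖x + s x • d x‖ ^ 2 = 1 := by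
      rw [norm_add_sq_real, norm_smul, mul_pow, Real.norm_eq_abs, sq_abs, inner_smul_right]
      refine mul_left_cancel₀ (hd0 x) ?_
      have h2 : (s x * ‖d x‖ ^ 2 + ⟪x, d x⟫) ^ 2 = disc x := by
        rw [hsd, neg_add_eq_sub, sub_add_cancel, hsq]
      simp only [disc] at h2
      linear_combination h2
    exact (pow_eq_one_iff_of_nonneg (norm_nonneg _) two_ne_zero).1 h1
  · intro x hx
    rw [mem_sphere_zero_iff_norm] at hx
    have : disc x = ⟪x, d x⟫ ^ 2 := by simp [disc, hx]
    simp [s, this, Real.sqrt_sq (hsphere x hx).le]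

/-- **Brouwer's fixed point theorem**, for bounded continuous self-maps. -/
theorem Continuous.exists_fixedPoint_of_norm_le {E : Type*} [NormedAddCommGroup E]
    [InnerProductSpace ℝ E] [FiniteDimensional ℝ E] {f : E → E} (hf : Continuous f) {R : ℝ}
    (hR : ∀ x, ‖f x‖ ≤ R) : ∃ x, f x = x := by
  -- Rescaling leaves room for an approximation within `1 / 2` that still has norm below `1`.
  wlog hR' : R = 1 / 2 generalizing f R
  · set c : ℝ := 2 * (|R| + 1)
    have hc : 0 < c := by positivity
    obtain ⟨x, hx⟩ := this (f := fun x => c⁻¹ • f (c • x)) (R := 1 / 2) (by fun_prop)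
      (fun x => by
        rw [norm_smul, norm_inv, Real.norm_of_nonneg hc.le, inv_mul_le_iff₀ hc]
        have := hR (c • x)
        have := le_abs_self R
        simp only [c]; linarith) rfl
    refine ⟨c • x, ?_⟩
    conv_rhs => rw [← hx]
    rw [smul_inv_smul₀ hc.ne']
  subst hR'
  by_contra! hne
  obtain ⟨x₀, -, hx₀⟩ := (isCompact_closedBall (0 : E) 1).exists_isMinOn
    ⟨0, mem_closedBall_self zero_le_one⟩ (f := fun x => ‖f x - x‖) (by fun_prop)
  -- A fixed point of an `ε`-approximation lies in the unit ball and is moved by `f` less than `ε`,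
  -- hence less than the minimal displacement there.
  set ε := min ‖f x₀ - x₀‖ (1 / 2)
  have hε : 0 < ε := lt_min (norm_pos_iff.2 (sub_ne_zero.2 (hne x₀))) (by norm_num)
  obtain ⟨k, hk, hkf, -⟩ := hf.exists_contDiff_approx 1 (ε := fun _ => ε) continuous_const
    (fun _ => hε)
  have hk1 : ∀ x, ‖k x‖ < 1 := fun x => by
    have h1 := hkf x
    rw [dist_eq_norm] at h1
    have h2 : ‖k x‖ ≤ ‖k x - f x‖ + ‖f x‖ := by simpa using norm_add_le (k x - f x) (f x)
    have := hR x
    have : ε ≤ 1 / 2 := min_le_right _ _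
    linarith
  obtain ⟨x, hx⟩ := ContDiff.exists_fixedPoint_of_norm_lt_one (by exact_mod_cast hk) hk1
  have h1 := hkf x
  have h2 : ‖f x₀ - x₀‖ ≤ ‖f x - x‖ := hx₀ (by
    rw [mem_closedBall_zero_iff, ← hx]; exact (hk1 x).le)
  rw [hx, dist_comm, dist_eq_norm] at h1
  have : ε ≤ ‖f x₀ - x₀‖ := min_le_left _ _
  linarith

/-! ### General position of coordinates -/

/-- The vectors that agree on `J` with some value of a continuously differentiable map form a set
of small Hausdorff dimension when `J` has more elements than the dimension of the source. -/
theorem dimH_setOf_eqOn_range_lt {E : Type*} [NormedAddCommGroup E] [NormedSpace ℝ E]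
    [FiniteDimensional ℝ E] {ι : Type*} [Fintype ι] {m : E → ι → ℝ} (hm : ContDiff ℝ 1 m)
    {J : Finset ι} (hJ : Module.finrank ℝ E < J.card) :
    dimH {c : ι → ℝ | ∃ y, ∀ i ∈ J, m y i = c i} < Module.finrank ℝ (ι → ℝ) := by
  classical
  -- The set is parametrized by `y` and the free coordinates off `J`, which is fewer parameters than
  -- `ι` has elements; a `C¹` map does not raise dimension above that of its source.
  let Φ : E × ({i // i ∉ J} → ℝ) → ι → ℝ := fun z i => if h : i ∈ J then m z.1 i else z.2 ⟨i, h⟩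
  have hΦ : ContDiff ℝ 1 Φ := by
    refine contDiff_pi.2 fun i => ?_
    by_cases h : i ∈ J
    · simp only [Φ, h, dif_pos]
      exact ((contDiff_apply ℝ ℝ i).comp hm).comp contDiff_fst
    · simp only [Φ, h, dif_neg, not_false_eq_true]
      exact (contDiff_apply ℝ ℝ _).comp contDiff_snd
  have hsub : {c : ι → ℝ | ∃ y, ∀ i ∈ J, m y i = c i} ⊆ range Φ := by
    rintro c ⟨y, hy⟩
    refine ⟨(y, fun i => c i), funext fun i => ?_⟩
    by_cases h : i ∈ J
    · simp only [Φ, h, dif_pos, hy i h]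
    · simp only [Φ, h, dif_neg, not_false_eq_true]
  refine ((dimH_mono hsub).trans hΦ.dimH_range_le).trans_lt ?_
  have hcard : Fintype.card {i // i ∉ J} = Fintype.card ι - J.card := by
    rw [Fintype.card_subtype_compl, Fintype.card_coe]
  have := J.card_le_univ
  rw [Nat.cast_lt, Module.finrank_prod, Module.finrank_fintype_fun_eq_card,
    Module.finrank_fintype_fun_eq_card, hcard]
  omega

/-- A continuous map from a space of dimension `d` to a coordinate space is a uniform limit of
continuous maps of which no `d + 1` coordinates vanish simultaneously. -/
theorem Continuous.exists_approx_coord_ne_zero {E : Type*} [NormedAddCommGroup E]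
    [NormedSpace ℝ E] [FiniteDimensional ℝ E] {ι : Type*} [Fintype ι] {m : E → ι → ℝ}
    (hm : Continuous m) {δ : ℝ} (hδ : 0 < δ) :
    ∃ m' : E → ι → ℝ, Continuous m' ∧ (∀ y, dist (m' y) (m y) < δ) ∧
      ∀ J : Finset ι, Module.finrank ℝ E < J.card → ∀ y, ∃ i ∈ J, m' y i ≠ 0 := by
  obtain ⟨g, hg, hgm, -⟩ := hm.exists_contDiff_approx 1 (ε := fun _ => δ / 2) continuous_const
    (fun _ => half_pos hδ)
  have hdense : Dense (⋃ J ∈ {J : Finset ι | Module.finrank ℝ E < J.card},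
      {c : ι → ℝ | ∃ y, ∀ i ∈ J, g y i = c i})ᶜ := by
    -- For empty `ι` the strict inequality between dimensions would read `0 < 0`, but no `J` is
    -- large enough, so the union is empty.
    rcases isEmpty_or_nonempty ι with hι | hι
    · exact dense_iff_closure_eq.2 (Subsingleton.eq_univ_of_nonempty
        (Dense.nonempty (by simp [Finset.eq_empty_of_isEmpty])).closure)
    refine dense_compl_of_dimH_lt_finrank ?_
    have hpos : (0 : ℝ≥0∞) < Module.finrank ℝ (ι → ℝ) := by
      exact_mod_cast Module.finrank_pos
    rw [dimH_bUnion (Set.toFinite _).countable]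
    simp_rw [← (Set.toFinite {J : Finset ι | Module.finrank ℝ E < J.card}).mem_toFinset]
    rw [← Finset.sup_eq_iSup, Finset.sup_lt_iff hpos]
    intro J hJ
    exact dimH_setOf_eqOn_range_lt (by exact_mod_cast hg) (by simpa using hJ)
  obtain ⟨c, hc, hcδ⟩ := hdense.exists_dist_lt 0 (half_pos hδ)
  refine ⟨fun y => g y - c, hg.continuous.sub continuous_const, fun y => ?_, fun J hJ y => ?_⟩
  · have h1 := hgm y
    have h2 : dist (g y - c) (g y) < δ / 2 := by
      rw [dist_eq_norm, sub_sub_cancel_left, norm_neg]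
      rwa [dist_zero_left] at hcδ
    linarith [dist_triangle (g y - c) (g y) (m y)]
  · by_contra! h
    refine hc (mem_biUnion (show J ∈ {J : Finset ι | _} from hJ) ⟨y, fun i hi => ?_⟩)
    exact sub_eq_zero.1 (h i hi)

/-- If no `d + 1` coordinates of a continuous map vanish simultaneously, then on a compact set at
most `d` coordinates are small simultaneously. -/
theorem IsCompact.exists_card_abs_lt_le {E : Type*} [TopologicalSpace E] {K : Set E}
    (hK : IsCompact K) {ι : Type*} [Fintype ι] {m : E → ι → ℝ} (hm : Continuous m) {d : ℕ}
    (h : ∀ J : Finset ι, d < J.card → ∀ y, ∃ i ∈ J, m y i ≠ 0) :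
    ∃ ε > 0, ∀ y ∈ K, (Finset.univ.filter fun i => |m y i| < ε).card ≤ d := by
  have hJ : ∀ J : Finset ι, ∀ᶠ ε in nhdsWithin (0 : ℝ) (Ioi 0), d < J.card →
      ∀ y ∈ K, ∃ i ∈ J, ε ≤ |m y i| := by
    intro J
    by_cases hd : d < J.card
    swap
    · exact Filter.Eventually.of_forall fun _ h => absurd h hd
    rcases K.eq_empty_or_nonempty with rfl | hne
    · exact Filter.Eventually.of_forall fun _ _ y hy => absurd hy (notMem_empty y)
    have hJne : J.Nonempty := Finset.card_pos.1 (by omega)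
    obtain ⟨y₀, -, hy₀⟩ := hK.exists_isMinOn hne (f := fun y => ∑ i ∈ J, |m y i|)
      (by fun_prop)
    have hpos : 0 < ∑ i ∈ J, |m y₀ i| := by
      obtain ⟨i, hi, hi0⟩ := h J hd y₀
      exact Finset.sum_pos' (fun _ _ => abs_nonneg _) ⟨i, hi, abs_pos.2 hi0⟩
    -- Some coordinate in `J` is at least the average, so every `ε` below the minimal average works
    -- for this `J`; the finitely many `J` are then combined.
    have hc : 0 < (∑ i ∈ J, |m y₀ i|) / J.card := div_pos hpos (by exact_mod_cast hJne.card_pos)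
    filter_upwards [Ioo_mem_nhdsGT hc] with ε hε _ y hy
    refine Finset.exists_le_of_sum_le hJne (?_ : ∑ _ ∈ J, ε ≤ _)
    refine le_trans ?_ (hy₀ hy)
    rw [Finset.sum_const, nsmul_eq_mul, mul_comm]
    exact ((lt_div_iff₀ (by exact_mod_cast hJne.card_pos)).1 hε.2).le
  obtain ⟨ε, hε, hε0⟩ := ((Filter.eventually_all.2 hJ).and self_mem_nhdsWithin).exists
  refine ⟨ε, hε0, fun y hy => ?_⟩
  by_contra! hlt
  obtain ⟨i, hi, hle⟩ := hε _ hlt y hy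
  exact absurd (Finset.mem_filter.1 hi).2 (not_lt.2 hle)

/-! ### Quasi-norms, unit balls and rescaling -/

theorem ENNReal.eq_top_or_toReal_pos {p : ℝ≥0∞} (hp : 0 < p) : p = ∞ ∨ 0 < p.toReal :=
  or_iff_not_imp_left.2 fun h => ENNReal.toReal_pos hp.ne' h

theorem PiLp.continuous_norm_real {ι : Type*} [Fintype ι] {p : ℝ≥0∞} (hp : 0 < p) :
    Continuous fun x : PiLp p fun _ : ι => ℝ => ‖x‖ := by
  rcases ENNReal.eq_top_or_toReal_pos hp with rfl | hp
  · exact continuous_norm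
  · simp_rw [PiLp.norm_eq_sum hp]
    refine Continuous.rpow_const (continuous_finsetSum _ fun i _ =>
      Continuous.rpow_const (by fun_prop) fun _ => Or.inr hp.le) fun _ => Or.inr (by positivity)

theorem PiLp.norm_le_norm_of_abs_le {ι : Type*} [Fintype ι] {p : ℝ≥0∞} (hp : 0 < p)
    {x y : PiLp p fun _ : ι => ℝ} (h : ∀ i, |x i| ≤ |y i|) : ‖x‖ ≤ ‖y‖ := by
  rcases ENNReal.eq_top_or_toReal_pos hp with rfl | hp
  · exact ciSup_mono (Set.finite_range _).bddAbove h
  · rw [PiLp.norm_eq_sum hp, PiLp.norm_eq_sum hp]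
    gcongr with i
    exact h i

theorem abs_le_one_of_mem_ellUnitBall {p q : ℝ≥0∞} {M : ℕ} (hq : 0 < q) {x : EllP p M}
    (hx : x ∈ ellUnitBall p q M) (i : Fin M) : |x i| ≤ 1 := by
  rcases ENNReal.eq_top_or_toReal_pos hq with rfl | hq'
  · simp only [ellUnitBall, mem_ofPred_eq, if_true] at hx
    exact hx i
  · have hqt : q ≠ ∞ := (ENNReal.toReal_pos_iff.1 hq').2.ne
    simp only [ellUnitBall, mem_ofPred_eq, if_neg hqt] at hx
    have h1 : |x i| ^ q.toReal ≤ 1 := (Finset.single_le_sum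
      (f := fun i => |x i| ^ q.toReal) (fun _ _ => by positivity) (Finset.mem_univ i)).trans hx
    by_contra! h
    exact absurd h1 (not_le.2 (Real.one_lt_rpow h hq'))

theorem isCompact_ellUnitBall {p q : ℝ≥0∞} {M : ℕ} (hq : 0 < q) :
    IsCompact (ellUnitBall p q M) := by
  have hclosed : IsClosed (ellUnitBall p q M) := by
    rcases ENNReal.eq_top_or_toReal_pos hq with rfl | hq'
    · simp only [ellUnitBall, if_true, ofPred_forall]
      exact isClosed_iInter fun i => isClosed_le (by fun_prop) continuous_const
    · have hqt : q ≠ ∞ := (ENNReal.toReal_pos_iff.1 hq').2.ne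
      simp only [ellUnitBall, if_neg hqt]
      exact isClosed_le (continuous_finsetSum _ fun i _ =>
        Continuous.rpow_const (by fun_prop) fun _ => Or.inr hq'.le) continuous_const
  have hbox : IsCompact (WithLp.toLp p '' Icc (fun _ : Fin M => (-1 : ℝ)) fun _ => 1) :=
    isCompact_Icc.image (PiLp.continuous_toLp p _)
  refine hbox.of_isClosed_subset hclosed fun x hx => ⟨x.ofLp, ?_, rfl⟩
  exact ⟨fun i => (abs_le.1 (abs_le_one_of_mem_ellUnitBall hq hx i)).1,
    fun i => (abs_le.1 (abs_le_one_of_mem_ellUnitBall hq hx i)).2⟩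

/-- The factor by which a vector of the unit cube is divided to bring it into `K_q^M`. -/
noncomputable def ellScale (q : ℝ≥0∞) {M : ℕ} (u : Fin M → ℝ) : ℝ :=
  if q = ∞ then 1 else max 1 ((∑ i, |u i| ^ q.toReal) ^ (1 / q.toReal))

theorem one_le_ellScale (q : ℝ≥0∞) {M : ℕ} (u : Fin M → ℝ) : 1 ≤ ellScale q u := by
  unfold ellScale; split_ifs
  · exact le_rfl
  · exact le_max_left _ _

theorem continuous_ellScale {q : ℝ≥0∞} (hq : 0 < q) {M : ℕ} :
    Continuous (ellScale q : (Fin M → ℝ) → ℝ) := by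
  rcases ENNReal.eq_top_or_toReal_pos hq with rfl | hq'
  · exact continuous_const.congr fun u => (if_pos rfl).symm
  · have hqt : q ≠ ∞ := (ENNReal.toReal_pos_iff.1 hq').2.ne
    refine Continuous.congr ?_ fun u => (if_neg hqt).symm
    exact continuous_const.max (Continuous.rpow_const (continuous_finsetSum _ fun i _ =>
      Continuous.rpow_const (by fun_prop) fun _ => Or.inr hq'.le) fun _ => Or.inr (by positivity))

theorem toLp_ellScale_smul_mem {p q : ℝ≥0∞} (hq : 0 < q) {M : ℕ} {u : Fin M → ℝ}
    (hu : ∀ i, |u i| ≤ 1) :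
    WithLp.toLp p ((ellScale q u)⁻¹ • u) ∈ ellUnitBall p q M := by
  rcases ENNReal.eq_top_or_toReal_pos hq with rfl | hq'
  · simpa [ellUnitBall, ellScale] using hu
  · have hqt : q ≠ ∞ := (ENNReal.toReal_pos_iff.1 hq').2.ne
    have hc : 0 < ellScale q u := zero_lt_one.trans_le (one_le_ellScale q u)
    have hle : (∑ i, |u i| ^ q.toReal) ^ (1 / q.toReal) ≤ ellScale q u := by
      rw [ellScale, if_neg hqt]; exact le_max_right _ _
    have hS : 0 ≤ ∑ i, |u i| ^ q.toReal := by positivity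
    rw [one_div, Real.rpow_inv_le_iff_of_pos hS hc.le hq'] at hle
    simp only [ellUnitBall, mem_ofPred_eq, if_neg hqt, Pi.smul_apply, smul_eq_mul, abs_mul,
      abs_inv, abs_of_pos hc]
    simp_rw [Real.mul_rpow (inv_nonneg.2 hc.le) (abs_nonneg _), ← Finset.mul_sum,
      Real.inv_rpow hc.le]
    exact (inv_mul_le_one₀ (by positivity)).2 hle

theorem card_filter_le_sum_abs_rpow {M : ℕ} (u : Fin M → ℝ) (r : ℝ) :
    ((Finset.univ.filter fun i => |u i| = 1).card : ℝ) ≤ ∑ i, |u i| ^ r := by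
  rw [Finset.card_filter, Nat.cast_sum]
  refine Finset.sum_le_sum fun i _ => ?_
  split_ifs with h
  · simp [h]
  · simp only [Nat.cast_zero]; positivity

/-- A vector of the unit cube with at least `k` unimodular coordinates has `ℓ_p` norm at least
`k ^ (1/p - 1/q)` after rescaling into `K_q^M`. -/
theorem rpow_le_norm_toLp_ellScale_smul {p q : ℝ≥0∞} (hp : 0 < p) (hpq : p ≤ q) {M : ℕ}
    {u : Fin M → ℝ} (hu : ∀ i, |u i| ≤ 1) {k : ℕ} (hk : 1 ≤ k)
    (hku : k ≤ (Finset.univ.filter fun i => |u i| = 1).card) :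
    (k : ℝ) ^ ((1 / p).toReal - (1 / q).toReal) ≤
      ‖(WithLp.toLp p ((ellScale q u)⁻¹ • u) : EllP p M)‖ := by
  have hk' : (1 : ℝ) ≤ k := by exact_mod_cast hk
  have hku' : (k : ℝ) ≤ (Finset.univ.filter fun i => |u i| = 1).card := by exact_mod_cast hku
  rcases ENNReal.eq_top_or_toReal_pos hp with rfl | hp'
  · obtain rfl : q = ∞ := top_le_iff.1 hpq
    obtain ⟨i, hi⟩ := Finset.card_pos.1 (lt_of_lt_of_le hk hku)
    have hi' : |u i| = 1 := (Finset.mem_filter.1 hi).2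
    simp only [sub_self, Real.rpow_zero, ellScale, if_true, inv_one, one_smul]
    rw [← hi']
    exact le_ciSup (f := fun i => ‖u i‖) (Set.finite_range _).bddAbove i
  have hkS := hku'.trans (card_filter_le_sum_abs_rpow u p.toReal)
  rw [PiLp.norm_eq_sum hp']
  rcases ENNReal.eq_top_or_toReal_pos (hp.trans_le hpq) with rfl | hq'
  · simp only [ellScale, if_true, inv_one, one_smul, Real.norm_eq_abs, one_div,
      ENNReal.inv_top, ENNReal.toReal_zero, sub_zero, ENNReal.toReal_inv]
    exact Real.rpow_le_rpow (by positivity) hkS (by positivity)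
  have hqt : q ≠ ∞ := (ENNReal.toReal_pos_iff.1 hq').2.ne
  have hpq' : p.toReal ≤ q.toReal := ENNReal.toReal_mono hqt hpq
  have hc : 0 < ellScale q u := zero_lt_one.trans_le (one_le_ellScale q u)
  set S := ∑ i, |u i| ^ p.toReal
  have hS : 0 < S := by linarith
  -- On the cube `|u i| ^ q ≤ |u i| ^ p`, and `S ≥ k ≥ 1` absorbs the `1` in the maximum.
  have hcS : ellScale q u ≤ S ^ (1 / q.toReal) := by
    rw [ellScale, if_neg hqt]
    refine max_le (Real.one_le_rpow (hk'.trans hkS) (by positivity)) ?_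
    refine Real.rpow_le_rpow (by positivity) (Finset.sum_le_sum fun i _ => ?_) (by positivity)
    rcases (abs_nonneg (u i)).eq_or_lt with h | h
    · rw [← h, Real.zero_rpow hq'.ne', Real.zero_rpow hp'.ne']
    · exact Real.rpow_le_rpow_of_exponent_ge h (hu i) hpq'
  simp only [Pi.smul_apply, smul_eq_mul, Real.norm_eq_abs, abs_mul, abs_inv, abs_of_pos hc]
  simp_rw [Real.mul_rpow (inv_nonneg.2 hc.le) (abs_nonneg _), ← Finset.mul_sum]
  rw [Real.mul_rpow (by positivity) hS.le, ← Real.rpow_mul (by positivity),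
    mul_one_div_cancel hp'.ne', Real.rpow_one, one_div, one_div, ENNReal.toReal_inv,
    ENNReal.toReal_inv, ← one_div, ← one_div]
  calc (k : ℝ) ^ (1 / p.toReal - 1 / q.toReal) ≤ S ^ (1 / p.toReal - 1 / q.toReal) :=
        Real.rpow_le_rpow (by positivity) hkS
          (sub_nonneg.2 (one_div_le_one_div_of_le hp' hpq'))
    _ = (S ^ (1 / q.toReal))⁻¹ * S ^ (1 / p.toReal) := by
        rw [Real.rpow_sub hS, div_eq_inv_mul]
    _ ≤ _ := by gcongr

/-- A vector with entries of a vector of `K_q^M` on a set of at most `k` coordinates and zero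
elsewhere has `ℓ_p` norm at most `k ^ (1/p - 1/q)`. -/
theorem norm_le_rpow_of_eq_zero_off {p q : ℝ≥0∞} (hp : 0 < p) (hpq : p ≤ q) {M : ℕ}
    {x w : EllP p M} (hx : x ∈ ellUnitBall p q M) {s : Finset (Fin M)} (hs : s.Nonempty)
    (hw : ∀ i ∈ s, w i = x i) (hw0 : ∀ i ∉ s, w i = 0) :
    ‖w‖ ≤ (s.card : ℝ) ^ ((1 / p).toReal - (1 / q).toReal) := by
  have hq := hp.trans_le hpq
  have hcard : (0 : ℝ) < s.card := by exact_mod_cast hs.card_pos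
  have hx1 := abs_le_one_of_mem_ellUnitBall hq hx
  rcases ENNReal.eq_top_or_toReal_pos hp with rfl | hp'
  · obtain rfl : q = ∞ := top_le_iff.1 hpq
    simp only [sub_self, Real.rpow_zero]
    refine Real.iSup_le (fun i => ?_) zero_le_one
    by_cases hi : i ∈ s
    · rw [hw i hi]; exact hx1 i
    · rw [hw0 i hi]; simp
  have hsum : ∑ i, ‖w i‖ ^ p.toReal = ∑ i ∈ s, |x i| ^ p.toReal := by
    rw [← Finset.sum_subset s.subset_univ fun i _ hi => by
      rw [hw0 i hi, norm_zero, Real.zero_rpow hp'.ne']]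
    exact Finset.sum_congr rfl fun i hi => by rw [hw i hi, Real.norm_eq_abs]
  rw [PiLp.norm_eq_sum hp', hsum]
  rcases ENNReal.eq_top_or_toReal_pos hq with rfl | hq'
  · simp only [one_div, ENNReal.inv_top, ENNReal.toReal_zero, sub_zero, ENNReal.toReal_inv]
    refine Real.rpow_le_rpow (by positivity) ?_ (by positivity)
    refine (Finset.sum_le_card_nsmul s _ 1 fun i _ => ?_).trans_eq (by simp)
    exact Real.rpow_le_one (abs_nonneg _) (hx1 i) hp'.le
  have hqt : q ≠ ∞ := (ENNReal.toReal_pos_iff.1 hq').2.ne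
  have hpq' : p.toReal ≤ q.toReal := ENNReal.toReal_mono hqt hpq
  simp only [ellUnitBall, mem_ofPred_eq, if_neg hqt] at hx
  have hr : 1 ≤ q.toReal / p.toReal := (one_le_div hp').2 hpq'
  -- Power mean inequality with exponent `q / p`, applied to `|x i| ^ p`.
  have h1 := Real.rpow_sum_le_const_mul_sum_rpow_of_nonneg s (f := fun i => |x i| ^ p.toReal) hr
    fun i _ => by positivity
  have h2 : ∑ i ∈ s, (|x i| ^ p.toReal) ^ (q.toReal / p.toReal) ≤ 1 := by
    refine le_trans (le_of_eq_of_le (Finset.sum_congr rfl fun i _ => ?_)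
      (Finset.sum_le_sum_of_subset_of_nonneg (f := fun i => |x i| ^ q.toReal)
        s.subset_univ fun _ _ _ => by positivity)) hx
    rw [← Real.rpow_mul (abs_nonneg _), mul_div_cancel₀ _ hp'.ne']
  have h3 := h1.trans (mul_le_of_le_one_right (by positivity) h2)
  have h4 := Real.rpow_le_rpow (by positivity) h3 (by positivity : 0 ≤ 1 / q.toReal)
  rw [← Real.rpow_mul (by positivity), ← Real.rpow_mul hcard.le] at h4
  rw [one_div, one_div, one_div, ENNReal.toReal_inv, ENNReal.toReal_inv]
  convert h4 using 2 <;> field_simp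

/-! ### Lower bound -/

/-- The vector of the unit cube with signs opposite to those of `z`, unimodular wherever
`ε ≤ |z i|`. -/
noncomputable def negClamp (ε : ℝ) {M : ℕ} (z : Fin M → ℝ) : Fin M → ℝ :=
  fun i => -max (-1) (min 1 (z i / ε))

theorem continuous_negClamp (ε : ℝ) {M : ℕ} :
    Continuous (negClamp ε : (Fin M → ℝ) → Fin M → ℝ) := by
  unfold negClamp; fun_prop

theorem abs_negClamp_le_one (ε : ℝ) {M : ℕ} (z : Fin M → ℝ) (i : Fin M) :
    |negClamp ε z i| ≤ 1 := by
  rw [negClamp, abs_neg, abs_le]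
  exact ⟨le_max_left _ _, max_le (by norm_num) (min_le_left _ _)⟩

theorem abs_negClamp_eq_one {ε : ℝ} (hε : 0 < ε) {M : ℕ} {z : Fin M → ℝ} {i : Fin M}
    (h : ε ≤ |z i|) : |negClamp ε z i| = 1 := by
  rw [negClamp, abs_neg]
  rcases le_abs.1 h with h | h
  · rw [min_eq_left ((one_le_div hε).2 h)]; norm_num
  · have h1 : z i / ε ≤ -1 := by rw [div_le_iff₀ hε]; linarith
    rw [min_eq_right (by linarith), max_eq_left h1]; norm_num

theorem negClamp_mul_nonpos {ε : ℝ} (hε : 0 < ε) {M : ℕ} (z : Fin M → ℝ) (i : Fin M) :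
    negClamp ε z i * z i ≤ 0 := by
  rw [negClamp]
  rcases le_total 0 (z i) with h | h
  · have : 0 ≤ max (-1) (min 1 (z i / ε)) :=
      le_max_of_le_right (le_min zero_le_one (by positivity))
    exact mul_nonpos_of_nonpos_of_nonneg (neg_nonpos.2 this) h
  · have : max (-1) (min 1 (z i / ε)) ≤ 0 :=
      max_le (by norm_num) (min_le_of_right_le (div_nonpos_of_nonpos_of_nonneg h hε.le))
    exact mul_nonpos_of_nonneg_of_nonpos (neg_nonneg.2 this) h

/-- Squaring, the cross term `-2 * x * z` is nonnegative. -/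
theorem abs_le_abs_sub_of_mul_nonpos {x z : ℝ} (h : x * z ≤ 0) : |x| ≤ |x - z| :=
  sq_le_sq.1 (by nlinarith [sq_nonneg z])

/-- For every encoder and decoder there is a large vector of `K_q^M` from which the decoded
vector is, coordinatewise, almost no closer than the origin. -/
theorem exists_mem_ellUnitBall_abs_sub_le {n M : ℕ} (hnM : n < M) {p q : ℝ≥0∞} (hp : 0 < p)
    (hpq : p ≤ q) (a : C(ellUnitBall p q M, EuclideanSpace ℝ (Fin n)))
    (m : C(EuclideanSpace ℝ (Fin n), EllP p M)) {δ : ℝ} (hδ : 0 < δ) :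
    ∃ x : ellUnitBall p q M,
      ((M : ℝ) - n) ^ ((1 / p).toReal - (1 / q).toReal) ≤ ‖(x : EllP p M)‖ ∧
      ∀ i, |(x : EllP p M) i| - δ ≤ |(x : EllP p M) i - m (a x) i| := by
  have hq := hp.trans_le hpq
  have : CompactSpace (ellUnitBall p q M) :=
    isCompact_iff_compactSpace.1 (isCompact_ellUnitBall hq)
  obtain ⟨m', hm', hmm', hm0⟩ := Continuous.exists_approx_coord_ne_zero
    (m := fun y => (m y).ofLp) ((PiLp.continuous_ofLp p _).comp m.continuous) hδ
  rw [finrank_euclideanSpace_fin] at hm0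
  have hK := isCompact_range a.continuous
  obtain ⟨ε, hε, hcard⟩ := hK.exists_card_abs_lt_le hm' hm0
  let G : (Fin M → ℝ) → ellUnitBall p q M := fun z =>
    ⟨WithLp.toLp p ((ellScale q (negClamp ε z))⁻¹ • negClamp ε z),
      toLp_ellScale_smul_mem hq (abs_negClamp_le_one ε z)⟩
  have hG : Continuous G := by
    refine Continuous.subtype_mk ((PiLp.continuous_toLp p _).comp ?_) _
    refine Continuous.smul (Continuous.inv₀ ((continuous_ellScale hq).comp
      (continuous_negClamp ε)) fun z => ?_) (continuous_negClamp ε)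
    exact (zero_lt_one.trans_le (one_le_ellScale q _)).ne'
  obtain ⟨R, hR⟩ := hK.isBounded.exists_norm_le
  obtain ⟨y, hy⟩ := Continuous.exists_fixedPoint_of_norm_le
    (f := fun y => a (G (m' y))) (a.continuous.comp (hG.comp hm')) (R := R)
    fun y => hR _ (mem_range_self _)
  refine ⟨G (m' y), ?_, fun i => ?_⟩
  · rw [← Nat.cast_sub hnM.le]
    refine rpow_le_norm_toLp_ellScale_smul hp hpq (abs_negClamp_le_one ε _) (by omega) ?_
    -- Being a fixed point puts `y` in the range of `a`, the only place where the bound on small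
    -- coordinates is known.
    have h1 := hcard y ⟨_, hy⟩
    have h2 := Finset.card_filter_add_card_filter_not (s := (Finset.univ : Finset (Fin M)))
      fun i => |m' y i| < ε
    rw [Finset.card_univ, Fintype.card_fin] at h2
    have h3 : (Finset.univ.filter fun i => ¬|m' y i| < ε).card ≤
        (Finset.univ.filter fun i => |negClamp ε (m' y) i| = 1).card :=
      Finset.card_le_card (Finset.monotone_filter_right Finset.univ fun i _ hi =>
        abs_negClamp_eq_one hε (not_lt.1 hi))
    omega
  · have hy' : a (G (m' y)) = y := hy
    rw [hy']
    have h1 : |m' y i - m y i| < δ := (dist_le_pi_dist (m' y) (m y).ofLp i).trans_lt (hmm' y)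
    have h2 : |(G (m' y) : EllP p M) i| ≤ |(G (m' y) : EllP p M) i - m' y i| := by
      refine abs_le_abs_sub_of_mul_nonpos ?_
      change (ellScale q _)⁻¹ * negClamp ε (m' y) i * m' y i ≤ 0
      rw [mul_assoc]
      exact mul_nonpos_of_nonneg_of_nonpos
        (inv_nonneg.2 (zero_le_one.trans (one_le_ellScale q _))) (negClamp_mul_nonpos hε _ i)
    have h3 := abs_sub_le ((G (m' y) : EllP p M) i) (m y i) (m' y i)
    rw [abs_sub_comm (m y i)] at h3
    linarith

/-- The slack `δ` is removed by compactness: `φ` records by how much coordinates of the error fall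
short of those of `x`. Its norm attains a minimum on the compact set of large vectors, and that
minimum is at most every `δ > 0`. -/
theorem exists_mem_ellUnitBall_le_norm_sub {n M : ℕ} (hnM : n < M) {p q : ℝ≥0∞} (hp : 0 < p)
    (hpq : p ≤ q) (a : C(ellUnitBall p q M, EuclideanSpace ℝ (Fin n)))
    (m : C(EuclideanSpace ℝ (Fin n), EllP p M)) :
    ∃ x : ellUnitBall p q M,
      ((M : ℝ) - n) ^ ((1 / p).toReal - (1 / q).toReal) ≤ ‖(x : EllP p M) - m (a x)‖ := by
  have : CompactSpace (ellUnitBall p q M) :=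
    isCompact_iff_compactSpace.1 (isCompact_ellUnitBall (hp.trans_le hpq))
  set T := ((M : ℝ) - n) ^ ((1 / p).toReal - (1 / q).toReal)
  let φ : ellUnitBall p q M → Fin M → ℝ := fun x i =>
    max 0 (|(x : EllP p M) i| - |(x : EllP p M) i - m (a x) i|)
  have hφ : Continuous φ := by
    refine continuous_pi fun i => ?_
    have h1 : Continuous fun x : ellUnitBall p q M => (x : EllP p M) i :=
      (PiLp.continuous_apply p _ i).comp continuous_subtype_val
    have h2 : Continuous fun x : ellUnitBall p q M => m (a x) i :=
      (PiLp.continuous_apply p _ i).comp (m.continuous.comp a.continuous)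
    fun_prop
  have hs : IsClosed {x : ellUnitBall p q M | T ≤ ‖(x : EllP p M)‖} :=
    isClosed_le continuous_const ((PiLp.continuous_norm_real hp).comp continuous_subtype_val)
  -- Any slack serves here; only nonemptiness of the set of large vectors is needed.
  obtain ⟨x₁, hx₁, -⟩ := exists_mem_ellUnitBall_abs_sub_le hnM hp hpq a m one_pos
  obtain ⟨x, hx, hmin⟩ := hs.isCompact.exists_isMinOn ⟨x₁, hx₁⟩ hφ.norm.continuousOn
  have hzero : ‖φ x‖ ≤ 0 := by
    refine le_of_forall_pos_le_add fun δ hδ => ?_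
    obtain ⟨x', hx', hδ'⟩ := exists_mem_ellUnitBall_abs_sub_le hnM hp hpq a m hδ
    rw [zero_add]
    refine (hmin hx').trans ((pi_norm_le_iff_of_nonneg hδ.le).2 fun i => ?_)
    rw [Real.norm_of_nonneg (le_max_left _ _)]
    exact max_le hδ.le (by linarith [hδ' i])
  refine ⟨x, le_trans hx (PiLp.norm_le_norm_of_abs_le hp fun i => ?_)⟩
  have h1 := (le_max_right _ _).trans
    ((Real.le_norm_self _).trans ((norm_le_pi_norm (φ x) i).trans hzero))
  exact sub_nonpos.1 h1

/-! ### Upper bound and conclusion -/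

theorem exists_encoder_decoder_norm_sub_le {n M : ℕ} (hnM : n < M) {p q : ℝ≥0∞} (hp : 0 < p)
    (hpq : p ≤ q) : ∃ (a : C(ellUnitBall p q M, EuclideanSpace ℝ (Fin n)))
      (m : C(EuclideanSpace ℝ (Fin n), EllP p M)), ∀ x : ellUnitBall p q M,
      ‖(x : EllP p M) - m (a x)‖ ≤ ((M : ℝ) - n) ^ ((1 / p).toReal - (1 / q).toReal) := by
  refine ⟨⟨fun x => WithLp.toLp 2 fun i => (x : EllP p M) (Fin.castLE hnM.le i), ?_⟩,
    ⟨fun y => WithLp.toLp p fun i => if h : (i : ℕ) < n then y ⟨i, h⟩ else 0, ?_⟩, fun x => ?_⟩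
  · refine (PiLp.continuous_toLp 2 _).comp (continuous_pi fun i => ?_)
    exact (PiLp.continuous_apply p _ _).comp continuous_subtype_val
  · refine (PiLp.continuous_toLp p _).comp (continuous_pi fun i => ?_)
    by_cases h : (i : ℕ) < n
    · simp only [h, dif_pos]; exact PiLp.continuous_apply 2 _ _
    · simp only [h, dif_neg, not_false_eq_true]; exact continuous_const
  · have hcard : (Finset.univ.filter fun i : Fin M => ¬(i : ℕ) < n).card = M - n := by
      have h2 := Finset.card_filter_add_card_filter_not (s := (Finset.univ : Finset (Fin M)))
        fun i => (i : ℕ) < n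
      rw [Finset.card_univ, Fintype.card_fin, Fin.card_filter_val_lt] at h2
      omega
    rw [← Nat.cast_sub hnM.le, ← hcard]
    refine norm_le_rpow_of_eq_zero_off hp hpq x.2 (Finset.card_pos.1 (by omega))
      (fun i hi => ?_) fun i hi => ?_
    · have h : ¬(i : ℕ) < n := (Finset.mem_filter.1 hi).2
      simp [h]
    · have h : (i : ℕ) < n := by simpa using hi
      simp [h, Fin.castLE]

theorem mainTheorem2 (n M : ℕ) (hn : 1 ≤ n) (hnM : n < M)
    (p q : ℝ≥0∞) (hp : 0 < p) (hpq : p ≤ q) :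
    manifoldWidth n (ellUnitBall p q M) =
      ENNReal.ofReal (((M : ℝ) - (n : ℝ)) ^ ((1 / p).toReal - (1 / q).toReal)) := by
  refine le_antisymm ?_ (le_iInf₂ fun a m => ?_)
  · obtain ⟨a, m, h⟩ := exists_encoder_decoder_norm_sub_le hnM hp hpq
    exact iInf₂_le_of_le a m (iSup_le fun x => ENNReal.ofReal_le_ofReal (h x))
  · obtain ⟨x, hx⟩ := exists_mem_ellUnitBall_le_norm_sub hnM hp hpq a m
    exact le_iSup_of_le x (ENNReal.ofReal_le_ofReal hx)
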